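/- Let $(p_j)_{j\ge 0}$ be real monic polynomials of degrees $k_j=\deg p_j\ge 1$, $$p_j(\lambda)=\lambda^{k_j}+p^{(j)}_{k_j-1}\lambda^{k_j-1}+\dots+p^{(j)}_1\lambda+p^{(j)}_0,$$ let $\varepsilon_j\in\{1,-1\}$ and $b_j>0$ for $j\ge 0$, and assume that $$\sup_j k_j<\infty,\qquad \sup\{\,b_j,\ |p^{(j)}_r| : j\ge 0,\ 0\le r\le k_j-1\,\}<\infty .$$ Let $H$ be the associated generalized Jacobi operator, that is, the bounded operator on the complex Hilbert space $\ell^2$ (with orthonormal basis $e_{j,r}$, $j\ge 0$, $0\le r\le k_j-1$) given by the block tridiagonal matrix $$H=\begin{pmatrix} A_0&\widetilde B_0& & \\ B_0&A_1&\widetilde B_1& \\ &B_1&A_2&\ddots\\ & &\ddots&\ddots\end{pmatrix},$$ where $A_j$ is the $k_j\times k_j$ companion matrix of $p_j$ (ones on the subdiagonal, last column $(-p^{(j)}_0,\dots,-p^{(j)}_{k_j-1})^\top$, zeros elsewhere), and where the $k_{j+1}\times k_j$ matrix $B_j$ and the $k_j\times k_{j+1}$ matrix $\widetilde B_j$ have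 a single nonzero entry, in the upper right corner, equal to $b_j$ and to $\varepsilon_j\varepsilon_{j+1}b_j$ respectively. Let $\rho(H)$ be the resolvent set of $H$, and let the polynomials of the first kind $P_j$ be defined by $$P_0=1,\qquad P_1=\frac{p_0}{b_0},\qquad \varepsilon_{j-1}\varepsilon_j b_{j-1}P_{j-1}-p_jP_j+b_jP_{j+1}=0\quad(j\ge 1).$$ Then for every $\lambda\in\rho(H)$ $$\limsup_{j\to\infty}|P_j(\lambda)|^{1/j}>1,$$ where the value $+\infty$ of the upper limit is allowed. -/

import Mathlib

open Filter Polynomial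
open scoped ENNReal NNReal lp

/-- The coefficient data of a generalized Jacobi matrix: real monic polynomials `p j` of degree
at least one, signs `ε j = ±1`, and positive numbers `b j`. -/
structure GenJacobiData where
  p : ℕ → ℝ[X]
  ε : ℕ → ℝ
  b : ℕ → ℝ
  monic : ∀ j, (p j).Monic
  degree_pos : ∀ j, 1 ≤ (p j).natDegree
  sign : ∀ j, ε j = 1 ∨ ε j = -1
  b_pos : ∀ j, 0 < b j

namespace GenJacobiData

/-- The block sizes `k j = deg p_j`. -/
def k (J : GenJacobiData) (j : ℕ) : ℕ := (J.p j).natDegree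

/-- The index set of the standard basis `e_{j,r}`, `j ≥ 0`, `0 ≤ r < k j`, of `ℓ²`. The pair
`(j, r)` labels the position `k 0 + ⋯ + k (j - 1) + r` of a sequence. -/
abbrev Index (J : GenJacobiData) : Type := Σ j : ℕ, Fin (J.k j)

/-- The polynomials of the first kind: `P_0 = 1`, `P_1 = p_0 / b_0` and
`ε_{j-1} ε_j b_{j-1} P_{j-1} - p_j P_j + b_j P_{j+1} = 0` for `j ≥ 1`. -/
noncomputable def P (J : GenJacobiData) : ℕ → ℝ[X]
  | 0 => 1
  | 1 => C (J.b 0)⁻¹ * J.p 0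
  | j + 2 => C (J.b (j + 1))⁻¹ *
      (J.p (j + 1) * J.P (j + 1) - C (J.ε j * J.ε (j + 1) * J.b j) * J.P j)

/-- The companion matrix of a polynomial of degree `n`: ones below the diagonal and
`-p_0, …, -p_{n-1}` in the last column. -/
noncomputable def companion (p : ℝ[X]) (n : ℕ) : Matrix (Fin n) (Fin n) ℝ := fun r s =>
  if s.val + 1 = n then -p.coeff r.val else if r.val = s.val + 1 then 1 else 0

/-- The `m × n` matrix whose only nonzero entry is `c`, in the upper right corner. -/
noncomputable def corner (m n : ℕ) (c : ℝ) : Matrix (Fin m) (Fin n) ℝ := fun r s =>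
  if r.val = 0 ∧ s.val + 1 = n then c else 0

/-- The block in position `(i, j)` of the generalized Jacobi matrix: the companion matrix of `p j`
on the diagonal, the corner matrix of `b j` at `(j + 1, j)`, the corner matrix of
`ε i * ε (i + 1) * b i` at `(i, i + 1)`, and zero elsewhere. -/
noncomputable def block (J : GenJacobiData) (i j : ℕ) : Matrix (Fin (J.k i)) (Fin (J.k j)) ℝ :=
  if h : i = j then h ▸ companion (J.p i) (J.k i)
  else if i = j + 1 then corner (J.k i) (J.k j) (J.b j)
  else if j = i + 1 then corner (J.k i) (J.k j) (J.ε i * J.ε (i + 1) * J.b i)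
  else 0

/-- The generalized Jacobi matrix, an infinite block tridiagonal matrix. -/
noncomputable def matrix (J : GenJacobiData) : Matrix J.Index J.Index ℂ :=
  fun x y => (J.block x.1 y.1 x.2 y.2 : ℂ)

/-- The degrees of the polynomials `p j` are uniformly bounded. -/
def BoundedDegrees (J : GenJacobiData) : Prop := ∃ N : ℕ, ∀ j, (J.p j).natDegree ≤ N

/-- The numbers `b j` and the non-leading coefficients of the `p j` are uniformly bounded. -/
def BoundedCoeffs (J : GenJacobiData) : Prop :=
  ∃ M : ℝ, ∀ j, J.b j ≤ M ∧ ∀ r < (J.p j).natDegree, |(J.p j).coeff r| ≤ M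

end GenJacobiData

/-- The absolute row and column sums of an infinite matrix are uniformly bounded. -/
def SchurBounded {ι : Type*} (A : Matrix ι ι ℂ) : Prop :=
  ∃ K : ℝ≥0, (∀ i, ∑' j, ‖A i j‖ₑ ≤ K) ∧ (∀ j, ∑' i, ‖A i j‖ₑ ≤ K)

namespace SchurBounded

theorem cauchy_schwarz {ι : Type*} (a x : ι → ℝ≥0∞) :
    (∑' j, a j * x j) ^ 2 ≤ (∑' j, a j) * ∑' j, a j * x j ^ 2 := by
  let _ : MeasurableSpace ι := ⊤
  have h := ENNReal.lintegral_mul_le_Lp_mul_Lq (MeasureTheory.Measure.count : MeasureTheory.Measure ι)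
    Real.HolderConjugate.two_two (f := fun j => a j ^ (1 / 2 : ℝ))
    (g := fun j => a j ^ (1 / 2 : ℝ) * x j)
    (measurable_from_top.aemeasurable) (measurable_from_top.aemeasurable)
  simp only [MeasureTheory.lintegral_count, Pi.mul_apply] at h
  have e1 : ∀ j, a j ^ (1 / 2 : ℝ) * (a j ^ (1 / 2 : ℝ) * x j) = a j * x j := by
    intro j
    rw [← mul_assoc, ← ENNReal.rpow_add_of_nonneg _ _ (by norm_num) (by norm_num)]
    norm_num
  have e2 : ∀ j, (a j ^ (1 / 2 : ℝ)) ^ (2 : ℝ) = a j := by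
    intro j; rw [← ENNReal.rpow_mul]; norm_num
  have e3 : ∀ j, (a j ^ (1 / 2 : ℝ) * x j) ^ (2 : ℝ) = a j * x j ^ 2 := by
    intro j; rw [ENNReal.mul_rpow_of_nonneg _ _ (by norm_num), e2]; norm_num
  simp only [e1, e2, e3] at h
  have h2 := pow_le_pow_left₀ (zero_le) h 2
  rw [mul_pow] at h2
  have e4 : ∀ t : ℝ≥0∞, (t ^ (1 / 2 : ℝ)) ^ 2 = t := by
    intro t; rw [← ENNReal.rpow_natCast, ← ENNReal.rpow_mul]; norm_num
  simpa only [e4] using h2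

theorem summable_row {ι : Type*} {A : Matrix ι ι ℂ} (hA : SchurBounded A) (x : ℓ²(ι, ℂ)) (i : ι) :
    Summable fun j => A i j * x j := by
  obtain ⟨K, hr, -⟩ := hA
  have h1 : Summable fun j => ‖A i j‖ := by
    have : ∑' j, ‖A i j‖ₑ ≠ ∞ := ne_top_of_le_ne_top ENNReal.coe_ne_top (hr i)
    exact NNReal.summable_coe.2 (ENNReal.tsum_coe_ne_top_iff_summable.1 this)
  refine Summable.of_norm_bounded (h1.mul_right ‖x‖) fun j => ?_
  rw [norm_mul]
  exact mul_le_mul_of_nonneg_left (lp.norm_apply_le_norm (by norm_num) x j) (norm_nonneg _)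

theorem tsum_enorm_sq {ι : Type*} (x : ℓ²(ι, ℂ)) :
    ∑' j, ‖x j‖ₑ ^ 2 = ENNReal.ofReal (‖x‖ ^ 2) := by
  have h : HasSum (fun j => ‖x j‖ ^ 2) (‖x‖ ^ 2) := by
    simpa using lp.hasSum_norm (p := 2) (by norm_num) x
  rw [← h.tsum_eq, ENNReal.ofReal_tsum_of_nonneg (fun j => by positivity) h.summable]
  refine tsum_congr fun j => ?_
  rw [ENNReal.ofReal_pow (norm_nonneg _), ofReal_norm]

theorem bound {ι : Type*} {A : Matrix ι ι ℂ} {K : ℝ≥0} (hr : ∀ i, ∑' j, ‖A i j‖ₑ ≤ K)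
    (hc : ∀ j, ∑' i, ‖A i j‖ₑ ≤ K) (x : ℓ²(ι, ℂ)) :
    ∑' i, ‖∑' j, A i j * x j‖ₑ ^ 2 ≤ ENNReal.ofReal ((K * ‖x‖) ^ 2) := by
  have h1 : ∀ i, ‖∑' j, A i j * x j‖ₑ ^ 2 ≤ K * ∑' j, ‖A i j‖ₑ * ‖x j‖ₑ ^ 2 := by
    intro i
    have hs := summable_row ⟨K, hr, hc⟩ x i
    have : ‖∑' j, A i j * x j‖ₑ ≤ ∑' j, ‖A i j‖ₑ * ‖x j‖ₑ := by
      simpa only [enorm_mul] using enorm_tsum_le_tsum_enorm (f := fun j => A i j * x j)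
    calc _ ≤ _ := pow_le_pow_left₀ zero_le this 2
      _ ≤ _ := cauchy_schwarz _ _
      _ ≤ _ := mul_le_mul_left (hr i) _
  calc _ ≤ ∑' i, K * ∑' j, ‖A i j‖ₑ * ‖x j‖ₑ ^ 2 := ENNReal.tsum_le_tsum h1
    _ = K * ∑' j, (∑' i, ‖A i j‖ₑ) * ‖x j‖ₑ ^ 2 := by
      rw [ENNReal.tsum_mul_left, ENNReal.tsum_comm]; simp only [ENNReal.tsum_mul_right]
    _ ≤ K * ∑' j, K * ‖x j‖ₑ ^ 2 := by
      gcongr with j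
      exact hc j
    _ = ENNReal.ofReal ((K * ‖x‖) ^ 2) := by
      rw [ENNReal.tsum_mul_left, tsum_enorm_sq, ENNReal.ofReal_pow (by positivity),
        ENNReal.ofReal_pow (by positivity), ENNReal.ofReal_mul (by positivity),
        ENNReal.ofReal_coe_nnreal]
      ring

theorem memℓp {ι : Type*} {A : Matrix ι ι ℂ} (hA : SchurBounded A) (x : ℓ²(ι, ℂ)) :
    Memℓp (fun i => ∑' j, A i j * x j) 2 := by
  obtain ⟨K, hr, hc⟩ := hA
  have h := ne_top_of_le_ne_top ENNReal.ofReal_ne_top (bound hr hc x)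
  refine memℓp_gen ?_
  have h2 : Summable fun i => (‖∑' j, A i j * x j‖₊ ^ 2 : ℝ≥0) := by
    refine ENNReal.tsum_coe_ne_top_iff_summable.1 ?_
    simpa only [ENNReal.coe_pow, enorm_eq_nnnorm] using h
  simpa using NNReal.summable_coe.2 h2

/-- The bounded operator on `ℓ²` given by matrix multiplication,
`(A x)_i = ∑_j A_{ij} x_j`. -/
noncomputable def operator {ι : Type*} {A : Matrix ι ι ℂ} (hA : SchurBounded A) :
    ℓ²(ι, ℂ) →L[ℂ] ℓ²(ι, ℂ) :=
  LinearMap.mkContinuousOfExistsBound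
    { toFun := fun x => ⟨fun i => ∑' j, A i j * x j, hA.memℓp x⟩
      map_add' := by
        intro x y
        ext i
        simp only [lp.coeFn_add, Pi.add_apply, mul_add]
        exact (hA.summable_row x i).tsum_add (hA.summable_row y i)
      map_smul' := by
        intro c x
        ext i
        simp only [lp.coeFn_smul, Pi.smul_apply, smul_eq_mul, RingHom.id_apply]
        rw [← tsum_mul_left]
        exact tsum_congr fun j => by ring }
    (by
      obtain ⟨K, hr, hc⟩ := hA
      refine ⟨K, fun x => ?_⟩
      have h := bound hr hc x
      have e := tsum_enorm_sq (⟨fun i => ∑' j, A i j * x j, memℓp ⟨K, hr, hc⟩ x⟩ : ℓ²(ι, ℂ))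
      exact (sq_le_sq₀ (norm_nonneg _) (by positivity)).1
        ((ENNReal.ofReal_le_ofReal_iff (by positivity)).1 (e.symm.le.trans h)))

theorem operator_apply {ι : Type*} {A : Matrix ι ι ℂ} (hA : SchurBounded A) (x : ℓ²(ι, ℂ)) (i : ι) :
    hA.operator x i = ∑' j, A i j * x j := rfl

end SchurBounded

namespace GenJacobiData

theorem block_self (J : GenJacobiData) (i : ℕ) : J.block i i = companion (J.p i) (J.k i) := by
  simp [block]

theorem abs_block_le (J : GenJacobiData) {M : ℝ}
    (hM : ∀ j, J.b j ≤ M ∧ ∀ r < (J.p j).natDegree, |(J.p j).coeff r| ≤ M)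
    (i j : ℕ) (r : Fin (J.k i)) (s : Fin (J.k j)) : |J.block i j r s| ≤ max M 1 := by
  have hb : ∀ j, |J.b j| ≤ max M 1 := fun j => by
    rw [abs_of_pos (J.b_pos j)]; exact (hM j).1.trans (le_max_left _ _)
  have hε : ∀ j, |J.ε j| = 1 := fun j => by rcases J.sign j with h | h <;> simp [h]
  by_cases h : i = j
  · subst h
    rw [block_self, companion]
    split_ifs
    · rw [abs_neg]; exact ((hM i).2 r r.2).trans (le_max_left _ _)
    · simp
    · simp
  · simp only [block, h, dite_false]
    split_ifs with h1 h2
    · rw [corner]; split_ifs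
      · exact hb j
      · simp
    · rw [corner]; split_ifs
      · rw [abs_mul, abs_mul, hε, hε]; simpa using hb i
      · simp
    · simp

theorem block_eq_zero (J : GenJacobiData) {i j : ℕ} (h : i ≠ j) (h1 : i ≠ j + 1) (h2 : j ≠ i + 1) :
    J.block i j = 0 := by
  simp [block, h, h1, h2]

theorem tsum_index_le (J : GenJacobiData) {N : ℕ} (hN : ∀ j, (J.p j).natDegree ≤ N) {K : ℝ≥0}
    (i : ℕ) (f : J.Index → ℝ≥0∞) (hf : ∀ y, f y ≤ K)
    (h0 : ∀ y : J.Index, i ≠ y.1 → i ≠ y.1 + 1 → y.1 ≠ i + 1 → f y = 0) :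
    ∑' y, f y ≤ ((3 * (N * K) : ℝ≥0) : ℝ≥0∞) := by
  rw [ENNReal.tsum_sigma']
  have hz : ∀ j ∉ ({i, i - 1, i + 1} : Finset ℕ), ∑' r : Fin (J.k j), f ⟨j, r⟩ = 0 := by
    intro j hj
    simp only [Finset.mem_insert, Finset.mem_singleton, not_or] at hj
    refine ENNReal.tsum_eq_zero.2 fun r => h0 ⟨j, r⟩ ?_ ?_ ?_ <;> simp only [ne_eq] <;> omega
  rw [tsum_eq_sum hz]
  have hb : ∀ j, ∑' r : Fin (J.k j), f ⟨j, r⟩ ≤ (N * K : ℝ≥0∞) := by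
    intro j
    rw [tsum_fintype]
    refine (Finset.sum_le_card_nsmul _ _ _ fun r _ => hf ⟨j, r⟩).trans ?_
    rw [Finset.card_univ, Fintype.card_fin, nsmul_eq_mul]
    gcongr
    exact hN j
  refine (Finset.sum_le_card_nsmul _ _ _ fun j _ => hb j).trans ?_
  rw [nsmul_eq_mul]
  push_cast
  gcongr
  exact_mod_cast Finset.card_le_three

theorem schurBounded (J : GenJacobiData) (hdeg : J.BoundedDegrees) (hcoeff : J.BoundedCoeffs) :
    SchurBounded J.matrix := by
  obtain ⟨N, hN⟩ := hdeg
  obtain ⟨M, hM⟩ := hcoeff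
  have hle : ∀ x y, ‖J.matrix x y‖ₑ ≤ ((max M 1).toNNReal : ℝ≥0∞) := by
    intro x y
    have h := J.abs_block_le hM x.1 y.1 x.2 y.2
    rw [matrix, ← ofReal_norm, Complex.norm_real, Real.norm_eq_abs]
    exact ENNReal.ofReal_le_ofReal h
  refine ⟨3 * (N * (max M 1).toNNReal), fun x => ?_, fun y => ?_⟩
  · refine J.tsum_index_le hN x.1 _ (fun y => hle x y) fun y h h1 h2 => ?_
    simp [matrix, J.block_eq_zero h h1 h2]
  · refine J.tsum_index_le hN y.1 _ (fun x => hle x y) fun x h h1 h2 => ?_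
    simp [matrix, J.block_eq_zero h.symm h2 h1]

/-- The generalized Jacobi operator: the bounded operator on `ℓ²` given by the generalized
Jacobi matrix. -/
noncomputable def operator (J : GenJacobiData) (hdeg : J.BoundedDegrees)
    (hcoeff : J.BoundedCoeffs) : ℓ²(J.Index, ℂ) →L[ℂ] ℓ²(J.Index, ℂ) :=
  (J.schurBounded hdeg hcoeff).operator

end GenJacobiData

/-! The infinite vector `u` with entries `z ^ r * P_j(z)` satisfies `uᵀ H = z uᵀ` entrywise, by the
recurrence for `P_j` (`hasSum_leftEigenvector_mul_matrix`). In `ℓ²` such a vector would obstruct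
surjectivity of `z - H`, but a growth bound `limsup ≤ 1` alone does not put `u` in `ℓ²`. A little
exponential decay is therefore inserted.

Let `D` multiply block `j` by `a ^ j`. Since `H` is block tridiagonal, `H_a = D⁻¹ H D` only rescales
the lower blocks by `a⁻¹` and the upper ones by `a`, so it is norm continuous at `a = 1`.
Invertibility is an open condition, so `z - H_a` is still invertible for some `a < 1`
(`exists_isUnit_weightedOperator`). If the upper limit were at most `1`, then `D u` would lie in
`ℓ²` (`memℓp_pow_mul_leftEigenvector`). It annihilates the range of `z - H_a`, which is all of `ℓ²`,
so `D u = 0`, although its first entry is `P_0 = 1`. -/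

namespace SchurBounded

variable {ι : Type*}

theorem mono {A B : Matrix ι ι ℂ} (hA : SchurBounded A) (h : ∀ i j, ‖B i j‖ₑ ≤ ‖A i j‖ₑ) :
    SchurBounded B := by
  obtain ⟨K, hr, hc⟩ := hA
  exact ⟨K, fun i => (ENNReal.tsum_le_tsum fun j => h i j).trans (hr i),
    fun j => (ENNReal.tsum_le_tsum fun i => h i j).trans (hc j)⟩

theorem operator_single [DecidableEq ι] {A : Matrix ι ι ℂ} (hA : SchurBounded A) (i j : ι) (c : ℂ) :
    hA.operator (lp.single 2 j c) i = A i j * c := by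
  rw [operator_apply, tsum_eq_single j]
  · simp
  · intro k hk
    simp [lp.single_apply, hk]

end SchurBounded

/-- If the bilinear pairing of `u` with the range of `T` vanishes on the images of the standard basis
vectors, then `T` being surjective forces `u = 0`. -/
theorem lp.eq_zero_of_hasSum_single_of_surjective {ι : Type*} [DecidableEq ι]
    {T : ℓ²(ι, ℂ) →L[ℂ] ℓ²(ι, ℂ)} (hT : Function.Surjective T) {u : ι → ℂ} (hu : Memℓp u 2)
    (h : ∀ j, HasSum (fun i => u i * T (lp.single 2 j 1) i) 0) : u = 0 := by
  -- Conjugation turns the inner product into the bilinear pairing with `u`.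
  let v : ℓ²(ι, ℂ) := star ⟨u, hu⟩
  have hφ : (innerSL ℂ v).comp T = 0 := by
    ext y
    have hy := (lp.hasSum_single (p := 2) (by norm_num) y).mapL ((innerSL ℂ v).comp T)
    refine hy.unique ?_
    rw [zero_apply]
    refine hasSum_zero.congr_fun fun j => ?_
    have e : lp.single 2 j (y j) = y j • (lp.single 2 j 1 : ℓ²(ι, ℂ)) := by
      rw [← lp.single_smul, smul_eq_mul, mul_one]
    rw [e, map_smul]
    have : inner ℂ v (T (lp.single 2 j 1)) = 0 := by
      refine (lp.hasSum_inner v (T (lp.single 2 j 1))).unique ?_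
      refine (h j).congr_fun fun i => ?_
      rw [show v i = star (u i) from rfl, RCLike.inner_apply, starRingEnd_apply, star_star, mul_comm]
    simp [this]
  funext i
  obtain ⟨y, hy⟩ := hT (lp.single 2 i 1)
  have h0 : inner ℂ v (T y) = 0 := congrArg (fun φ => φ y) hφ
  rw [hy, lp.inner_single_right] at h0
  simpa [v] using h0

/-! ### The formal left eigenvector -/

namespace GenJacobiData

variable (J : GenJacobiData)

/-- The formal left eigenvector `z ^ r * P_j(z)` of the generalized Jacobi matrix. -/
noncomputable def leftEigenvector (z : ℂ) (x : J.Index) : ℂ :=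
  z ^ x.2.val * aeval z (J.P x.1)

theorem b_mul_aeval_P_one (z : ℂ) :
    (J.b 0 : ℂ) * aeval z (J.P 1) = aeval z (J.p 0) * aeval z (J.P 0) := by
  have hb : (J.b 0 : ℂ) ≠ 0 := by exact_mod_cast (J.b_pos 0).ne'
  simp [P, hb]

theorem b_mul_aeval_P_add_two (z : ℂ) (j : ℕ) :
    (J.b (j + 1) : ℂ) * aeval z (J.P (j + 2)) = aeval z (J.p (j + 1)) * aeval z (J.P (j + 1))
      - (J.ε j * J.ε (j + 1) * J.b j : ℝ) * aeval z (J.P j) := by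
  have hb : (J.b (j + 1) : ℂ) ≠ 0 := by exact_mod_cast (J.b_pos (j + 1)).ne'
  rw [P]
  simp only [map_mul, map_sub, aeval_C, Complex.coe_algebraMap, Complex.ofReal_inv]
  rw [← mul_assoc, mul_inv_cancel₀ hb, one_mul]
  push_cast
  rfl

/-- The row `(1, z, …, z^(n-1))` is a left eigenvector of the companion matrix up to a defect `p(z)`
in the last column. -/
theorem sum_pow_mul_companion {p : ℝ[X]} (hp : p.Monic) (z : ℂ) (s : Fin p.natDegree) :
    ∑ r : Fin p.natDegree, z ^ r.val * (companion p p.natDegree r s : ℂ)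
      = z ^ (s.val + 1) - if s.val + 1 = p.natDegree then aeval z p else 0 := by
  by_cases hs : s.val + 1 = p.natDegree
  · have h : aeval z p = ∑ r : Fin p.natDegree, z ^ r.val * (p.coeff r : ℂ) + z ^ p.natDegree := by
      rw [aeval_eq_sum_range, Finset.sum_range_succ, Finset.sum_range, hp.coeff_natDegree, one_smul]
      congr 1
      refine Finset.sum_congr rfl fun r _ => ?_
      rw [Complex.real_smul, mul_comm]
    simp [companion, hs, h]
  · have hs' : s.val + 1 < p.natDegree := by omega
    rw [Finset.sum_eq_single ⟨s.val + 1, hs'⟩]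
    · simp [companion, hs]
    · intro r _ hr
      have : r.val ≠ s.val + 1 := fun h => hr (Fin.ext h)
      simp [companion, hs, this]
    · simp

theorem sum_pow_mul_corner {m n : ℕ} (hm : 1 ≤ m) (c : ℝ) (z : ℂ) (s : Fin n) :
    ∑ r : Fin m, z ^ r.val * (corner m n c r s : ℂ) = if s.val + 1 = n then (c : ℂ) else 0 := by
  rw [Finset.sum_eq_single ⟨0, hm⟩]
  · split_ifs with h <;> simp [corner, h]
  · intro r _ hr
    have : r.val ≠ 0 := fun h => hr (Fin.ext h)
    simp [corner, this]
  · simp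

/-- The contribution of the block row `i` to a column of the product of the left eigenvector
with the generalized Jacobi matrix. -/
theorem sum_leftEigenvector_mul_matrix (z : ℂ) (i : ℕ) (y : J.Index) :
    ∑ r : Fin (J.k i), J.leftEigenvector z ⟨i, r⟩ * J.matrix ⟨i, r⟩ y
      = aeval z (J.P i) * ∑ r : Fin (J.k i), z ^ r.val * (J.block i y.1 r y.2 : ℂ) := by
  rw [Finset.mul_sum]
  refine Finset.sum_congr rfl fun r _ => ?_
  simp only [leftEigenvector, matrix]
  ring

/-- The companion defect `p_j P_j` and the corner entries of the neighbouring blocks all sit in the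
last column of block `j`, where they cancel by the recurrence. -/
theorem hasSum_leftEigenvector_mul_matrix (z : ℂ) (y : J.Index) :
    HasSum (fun x => J.leftEigenvector z x * J.matrix x y) (z * J.leftEigenvector z y) := by
  obtain ⟨j, s⟩ := y
  -- Column block `j` meets only row blocks up to `j + 1`, so the sum is finite.
  have hfin : ∀ x ∉ (Finset.range (j + 2)).sigma fun i => (Finset.univ : Finset (Fin (J.k i))),
      J.leftEigenvector z x * J.matrix x ⟨j, s⟩ = 0 := by
    intro x hx
    simp only [Finset.mem_sigma, Finset.mem_range, Finset.mem_univ, and_true] at hx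
    simp [matrix, J.block_eq_zero (i := x.1) (j := j) (by omega) (by omega) (by omega)]
  have hsum := hasSum_sum_of_ne_finset_zero (L := .unconditional _) hfin
  convert hsum using 1
  rw [Finset.sum_sigma]
  simp only [sum_leftEigenvector_mul_matrix]
  have hself : ∑ r : Fin (J.k j), z ^ r.val * (J.block j j r s : ℂ)
      = z ^ (s.val + 1) - if s.val + 1 = J.k j then aeval z (J.p j) else 0 := by
    rw [block_self]
    exact sum_pow_mul_companion (J.monic j) z s
  have hlow : ∑ r : Fin (J.k (j + 1)), z ^ r.val * (J.block (j + 1) j r s : ℂ)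
      = if s.val + 1 = J.k j then (J.b j : ℂ) else 0 := by
    have : J.block (j + 1) j = corner _ _ (J.b j) := by simp [block]
    rw [this]
    exact sum_pow_mul_corner (J.degree_pos _) _ z s
  rw [Finset.sum_range_succ, Finset.sum_range_succ, hself, hlow]
  cases j with
  | zero =>
    have := J.b_mul_aeval_P_one z
    simp only [leftEigenvector, Finset.range_zero, Finset.sum_empty]
    split_ifs
    · linear_combination -this
    · ring
  | succ m =>
    have hup : ∑ r : Fin (J.k m), z ^ r.val * (J.block m (m + 1) r s : ℂ)
        = if s.val + 1 = J.k (m + 1) then ((J.ε m * J.ε (m + 1) * J.b m : ℝ) : ℂ) else 0 := by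
      have : J.block m (m + 1) = corner _ _ (J.ε m * J.ε (m + 1) * J.b m) := by
        simp [block, show m ≠ m + 1 + 1 by omega]
      rw [this]
      exact sum_pow_mul_corner (J.degree_pos _) _ z s
    have hzero : ∀ i ∈ Finset.range m,
        aeval z (J.P i) * ∑ r : Fin (J.k i), z ^ r.val * (J.block i (m + 1) r s : ℂ) = 0 := by
      intro i hi
      have := Finset.mem_range.1 hi
      simp [J.block_eq_zero (i := i) (j := m + 1) (by omega) (by omega) (by omega)]
    have := J.b_mul_aeval_P_add_two z m
    rw [Finset.sum_range_succ, Finset.sum_eq_zero hzero, hup]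
    simp only [leftEigenvector]
    split_ifs
    · linear_combination -this
    · ring

/-! ### Conjugation by exponential weights -/

/-- The strictly lower block triangular part of the generalized Jacobi matrix. -/
noncomputable def lowerMatrix : Matrix J.Index J.Index ℂ :=
  fun x y => if x.1 = y.1 + 1 then J.matrix x y else 0

/-- The strictly upper block triangular part of the generalized Jacobi matrix. -/
noncomputable def upperMatrix : Matrix J.Index J.Index ℂ :=
  fun x y => if y.1 = x.1 + 1 then J.matrix x y else 0

theorem schurBounded_lowerMatrix (hdeg : J.BoundedDegrees) (hcoeff : J.BoundedCoeffs) :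
    SchurBounded J.lowerMatrix :=
  (J.schurBounded hdeg hcoeff).mono fun x y => by
    rw [lowerMatrix]; split_ifs <;> simp

theorem schurBounded_upperMatrix (hdeg : J.BoundedDegrees) (hcoeff : J.BoundedCoeffs) :
    SchurBounded J.upperMatrix :=
  (J.schurBounded hdeg hcoeff).mono fun x y => by
    rw [upperMatrix]; split_ifs <;> simp

/-- The operator `D⁻¹ H D` where `D` multiplies the block `j` by `a ^ j`. -/
noncomputable def weightedOperator (hdeg : J.BoundedDegrees) (hcoeff : J.BoundedCoeffs) (a : ℝ) :
    ℓ²(J.Index, ℂ) →L[ℂ] ℓ²(J.Index, ℂ) :=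
  J.operator hdeg hcoeff
    + (((a⁻¹ - 1 : ℝ) : ℂ) • (J.schurBounded_lowerMatrix hdeg hcoeff).operator
      + ((a - 1 : ℝ) : ℂ) • (J.schurBounded_upperMatrix hdeg hcoeff).operator)

theorem weightedOperator_single (hdeg : J.BoundedDegrees) (hcoeff : J.BoundedCoeffs) (a : ℝ)
    (x y : J.Index) :
    J.weightedOperator hdeg hcoeff a (lp.single 2 y 1) x = J.matrix x y
      + (((a⁻¹ - 1 : ℝ) : ℂ) * J.lowerMatrix x y + ((a - 1 : ℝ) : ℂ) * J.upperMatrix x y) := by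
  simp only [weightedOperator, operator, add_apply,
    smul_apply, lp.coeFn_add, lp.coeFn_smul, Pi.add_apply, Pi.smul_apply,
    smul_eq_mul, SchurBounded.operator_single, mul_one]

/-- This is `D H_a = H D`, entry by entry. -/
theorem pow_mul_weightedOperator_single (hdeg : J.BoundedDegrees) (hcoeff : J.BoundedCoeffs)
    {a : ℝ} (ha : a ≠ 0) (x y : J.Index) :
    (a : ℂ) ^ x.1 * J.weightedOperator hdeg hcoeff a (lp.single 2 y 1) x
      = (a : ℂ) ^ y.1 * J.matrix x y := by
  have ha' : (a : ℂ) ≠ 0 := by exact_mod_cast ha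
  rw [weightedOperator_single, lowerMatrix, upperMatrix]
  by_cases h1 : x.1 = y.1 + 1
  · rw [if_pos h1, if_neg (by omega), h1]
    push_cast
    field_simp
    ring
  by_cases h2 : y.1 = x.1 + 1
  · rw [if_neg h1, if_pos h2, h2]
    push_cast
    ring
  rw [if_neg h1, if_neg h2]
  by_cases h : x.1 = y.1
  · simp [h]
  · simp [matrix, J.block_eq_zero h h1 h2]

theorem continuousAt_weightedOperator (hdeg : J.BoundedDegrees) (hcoeff : J.BoundedCoeffs) :
    ContinuousAt (J.weightedOperator hdeg hcoeff) 1 := by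
  have h : ContinuousAt (fun a : ℝ => a⁻¹) 1 := continuousAt_inv₀ one_ne_zero
  have hc : Continuous fun t : ℝ => (t : ℂ) := Complex.continuous_ofReal
  have h1 : ContinuousAt (fun a : ℝ => ((a⁻¹ - 1 : ℝ) : ℂ)) 1 :=
    hc.continuousAt.comp (h.sub continuousAt_const)
  have h2 : ContinuousAt (fun a : ℝ => ((a - 1 : ℝ) : ℂ)) 1 := by fun_prop
  exact continuousAt_const.add ((h1.smul continuousAt_const).add (h2.smul continuousAt_const))

theorem weightedOperator_one (hdeg : J.BoundedDegrees) (hcoeff : J.BoundedCoeffs) :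
    J.weightedOperator hdeg hcoeff 1 = J.operator hdeg hcoeff := by
  simp [weightedOperator]

theorem exists_isUnit_weightedOperator (hdeg : J.BoundedDegrees) (hcoeff : J.BoundedCoeffs)
    {z : ℂ} (hz : z ∈ resolventSet ℂ (J.operator hdeg hcoeff)) :
    ∃ a : ℝ, 0 < a ∧ a < 1 ∧
      IsUnit (algebraMap ℂ (ℓ²(J.Index, ℂ) →L[ℂ] ℓ²(J.Index, ℂ)) z
        - J.weightedOperator hdeg hcoeff a) := by
  have hcont : ContinuousAt (fun a => algebraMap ℂ (ℓ²(J.Index, ℂ) →L[ℂ] ℓ²(J.Index, ℂ)) z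
      - J.weightedOperator hdeg hcoeff a) 1 :=
    continuousAt_const.sub (J.continuousAt_weightedOperator hdeg hcoeff)
  have hone : IsUnit (algebraMap ℂ (ℓ²(J.Index, ℂ) →L[ℂ] ℓ²(J.Index, ℂ)) z
      - J.weightedOperator hdeg hcoeff 1) := by
    rw [weightedOperator_one]
    exact hz
  have hev := hcont.eventually (Units.isOpen.mem_nhds hone)
  -- Approaching `1` from the left makes the weights `a ^ j` decay.
  obtain ⟨a, h, ha0, ha1⟩ := ((hev.filter_mono nhdsWithin_le_nhds).and
    (Ioo_mem_nhdsLT (zero_lt_one (α := ℝ)))).exists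
  exact ⟨a, ha0, ha1, h⟩

theorem memℓp_pow_mul_leftEigenvector (hdeg : J.BoundedDegrees) {z : ℂ} {a c : ℝ} (ha : 0 < a)
    (hc : 0 < c) (hac : a * c < 1) (hP : ∀ᶠ j in atTop, ‖aeval z (J.P j)‖ ≤ c ^ j) :
    Memℓp (fun x : J.Index => (a : ℂ) ^ x.1 * J.leftEigenvector z x) 2 := by
  obtain ⟨N, hN⟩ := hdeg
  refine memℓp_gen ?_
  have hnonneg : ∀ x : J.Index,
      0 ≤ ‖(a : ℂ) ^ x.1 * J.leftEigenvector z x‖ ^ (2 : ℝ≥0∞).toReal := fun x => by positivity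
  refine (summable_sigma_of_nonneg hnonneg).2 ⟨fun j => Summable.of_finite, ?_⟩
  -- `N` bounds the number of entries in a block, and `max 1 ‖z‖ ^ N` bounds every power of `z`
  -- there.
  have hgeo : Summable fun j : ℕ => N * (max 1 ‖z‖ ^ N) ^ 2 * ((a * c) ^ 2) ^ j :=
    (summable_geometric_of_lt_one (by positivity)
      (pow_lt_one₀ (by positivity) hac two_ne_zero)).mul_left _
  refine Summable.of_norm_bounded_eventually_nat hgeo ?_
  filter_upwards [hP] with j hj
  rw [Real.norm_of_nonneg (tsum_nonneg fun r => hnonneg ⟨j, r⟩), tsum_fintype]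
  have hterm : ∀ r : Fin (J.k j),
      ‖(a : ℂ) ^ j * J.leftEigenvector z ⟨j, r⟩‖ ^ (2 : ℝ≥0∞).toReal
        ≤ (max 1 ‖z‖ ^ N) ^ 2 * ((a * c) ^ 2) ^ j := by
    intro r
    have hz : ‖z‖ ^ r.val ≤ max 1 ‖z‖ ^ N :=
      (pow_le_pow_left₀ (norm_nonneg z) (le_max_right _ _) _).trans
        (pow_le_pow_right₀ (le_max_left _ _) (r.2.le.trans (hN j)))
    calc _ = (a ^ j * (‖z‖ ^ r.val * ‖aeval z (J.P j)‖)) ^ 2 := by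
          simp [leftEigenvector, abs_of_pos ha]
      _ ≤ (a ^ j * (max 1 ‖z‖ ^ N * c ^ j)) ^ 2 := by gcongr
      _ = _ := by rw [mul_pow a c, mul_pow (a ^ 2)]; ring
  refine (Finset.sum_le_card_nsmul _ _ _ fun r _ => hterm r).trans ?_
  rw [Finset.card_univ, Fintype.card_fin, nsmul_eq_mul, mul_assoc]
  have : (J.k j : ℝ) ≤ N := by exact_mod_cast hN j
  gcongr

end GenJacobiData

/-! ### Growth bound and conclusion -/

theorem eventually_norm_le_pow_of_limsup_lt {E : Type*} [SeminormedAddGroup E] {f : ℕ → E} {c : ℝ}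
    (hc : 0 ≤ c)
    (h : limsup (fun j : ℕ => ‖f j‖ₑ ^ (1 / (j : ℝ))) atTop < ENNReal.ofReal c) :
    ∀ᶠ j in atTop, ‖f j‖ ≤ c ^ j := by
  -- The index `0` is excluded because there the exponent `1 / j` is `0` by convention.
  filter_upwards [eventually_lt_of_limsup_lt h, eventually_ge_atTop 1] with j hj hj1
  have hpos : (0 : ℝ) < j := by exact_mod_cast hj1
  have h1 := ENNReal.rpow_le_rpow hj.le hpos.le
  rw [← ENNReal.rpow_mul, one_div_mul_cancel hpos.ne', ENNReal.rpow_one, ENNReal.rpow_natCast,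
    ← ENNReal.ofReal_pow hc, ← ofReal_norm] at h1
  exact (ENNReal.ofReal_le_ofReal_iff (by positivity)).1 h1

/-- At every point of the resolvent set of a generalized Jacobi operator the polynomials of the
first kind satisfy `limsup |P_j(z)|^{1/j} > 1`. The upper limit is taken in `[0, ∞]`. -/
theorem proposition7p4 (J : GenJacobiData) (hdeg : J.BoundedDegrees) (hcoeff : J.BoundedCoeffs)
    (z : ℂ) (hz : z ∈ resolventSet ℂ (J.operator hdeg hcoeff)) :
    1 < limsup (fun j : ℕ => ‖aeval z (J.P j)‖ₑ ^ (1 / (j : ℝ))) atTop := by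
  classical
  by_contra hlim
  rw [not_lt] at hlim
  obtain ⟨a, ha0, ha1, hunit⟩ := J.exists_isUnit_weightedOperator hdeg hcoeff hz
  -- `c > 1` exceeds the assumed growth rate, and `c < a⁻¹` lets the weights absorb `c ^ j`.
  obtain ⟨c, hc1, hca⟩ := exists_between ((one_lt_inv₀ ha0).2 ha1)
  have hc0 : 0 < c := zero_lt_one.trans hc1
  have hac : a * c < 1 := by
    have := mul_lt_mul_of_pos_left hca ha0
    rwa [mul_inv_cancel₀ ha0.ne'] at this
  have hP : ∀ᶠ j in atTop, ‖aeval z (J.P j)‖ ≤ c ^ j :=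
    eventually_norm_le_pow_of_limsup_lt hc0.le
      (hlim.trans_lt (by simpa using (ENNReal.one_lt_ofReal.2 hc1)))
  have hmem := J.memℓp_pow_mul_leftEigenvector hdeg ha0 hc0 hac hP
  have hsurj := (ContinuousLinearMap.isUnit_iff_bijective.1 hunit).2
  have hzero := lp.eq_zero_of_hasSum_single_of_surjective hsurj hmem fun y => by
    -- Column `y` of `(D u)ᵀ (z - H_a)`: the diagonal part minus `a ^ y.1` times column `y` of `uᵀ
    -- H`.
    have h1 := (hasSum_ite_eq y (z * ((a : ℂ) ^ y.1 * J.leftEigenvector z y))).sub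
      ((J.hasSum_leftEigenvector_mul_matrix z y).mul_left ((a : ℂ) ^ y.1))
    rw [show z * ((a : ℂ) ^ y.1 * J.leftEigenvector z y)
      - (a : ℂ) ^ y.1 * (z * J.leftEigenvector z y) = 0 by ring] at h1
    refine h1.congr_fun fun x => ?_
    have h2 := J.pow_mul_weightedOperator_single hdeg hcoeff ha0.ne' x y
    have h3 : (algebraMap ℂ (ℓ²(J.Index, ℂ) →L[ℂ] ℓ²(J.Index, ℂ)) z
        - J.weightedOperator hdeg hcoeff a) (lp.single 2 y 1) x
        = (if x = y then z else 0) - J.weightedOperator hdeg hcoeff a (lp.single 2 y 1) x := by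
      change z * (lp.single 2 y 1 : ℓ²(J.Index, ℂ)) x - _ = _
      by_cases hxy : x = y
      · subst hxy; simp
      · simp [hxy]
    rw [h3]
    split_ifs with hxy
    · subst hxy
      linear_combination -J.leftEigenvector z x * h2
    · linear_combination -J.leftEigenvector z x * h2
  have := congrFun hzero ⟨0, ⟨0, J.degree_pos 0⟩⟩
  simp [GenJacobiData.leftEigenvector, GenJacobiData.P] at this
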